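/- Let $\boldsymbol{\nu}:\mathbb{N}=\{1,2,\dots\}\to\mathbb{C}$ be a multiplicative function (that is, $\boldsymbol{\nu}(1)=1$ and $\boldsymbol{\nu}(mn)=\boldsymbol{\nu}(m)\boldsymbol{\nu}(n)$ whenever $m,n$ are coprime) with $|\boldsymbol{\nu}(n)|\le 1$ for all $n$. Then, for each nonconstant polynomial $P\in\mathbb{R}[x]$ with irrational leading coefficient, \[ \frac1M\sum_{M\le m<2M}\frac1H\left|\sum_{m\le n<m+H}e^{2\pi iP(n)}\boldsymbol{\nu}(n)\right|\longrightarrow 0 \] as the positive integers $M,H$ satisfy $M\to\infty$, $H\to\infty$, $H/M\to0$; that is, for every $\varepsilon>0$ there are $N\in\mathbb{N}$ and $\delta>0$ such that the left-hand side is less than $\varepsilon$ for all integers $M\ge N$, $H\ge N$ with $H/M<\delta$. -/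

import Mathlib

open Filter Topology

/-!
The absolute values on the short sums are absorbed into unimodular weights: the windows
`[m, m + H)` with `m` in a fixed residue class modulo `H` are disjoint, so the sum over these `m`
is `∑ W n * e(P n) * ν n` with a step function `W` that changes value rarely. Kátai's criterion
then removes `ν`. Let `S` be a finite set of primes and `A` the sum of their reciprocals. By
Turán–Kubilius the number of primes of `S` dividing `n` is `A` up to `O(√A)` on average, and
expanding it, with `ν (p * m) = ν p * ν m` outside the multiples of `p`, turns `A` times the sum
into sums over `m` of `ν m * ∑ p ∈ S, ν p * a (p * m)`, where `a n = W n * e(P n)`. Cauchy–Schwarz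
reduces these to the correlations of `a (p * m)` and `a (q * m)` for `p ≠ q`. On the long
intervals where the weights are constant this is an exponential sum of `P (p * m) - P (q * m)`,
whose leading coefficient is `p ^ d - q ^ d` times that of `P`, hence irrational, and Weyl
differencing makes it `o(L)` on intervals of length `L`, uniformly in their position. Since `A` is
as large as we please, the total is `O(N / √A)`.
-/

open Finset
open scoped ComplexConjugate FourierTransform

/-- The sums of `u` over intervals of length `L` are `o(L)`, uniformly in the position of the
interval. The error is split as `ε * L + C` so that the bound makes sense for every `L`. -/
def HasUniformMeanZero (u : ℕ → ℂ) : Prop :=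
  ∀ ε : ℝ, 0 < ε → ∃ C : ℝ, ∀ a L : ℕ, ‖∑ n ∈ range L, u (a + n)‖ ≤ ε * L + C

namespace HasUniformMeanZero

variable {u : ℕ → ℂ}

lemma eventually_le (hu : HasUniformMeanZero u) {ε : ℝ} (hε : 0 < ε) :
    ∀ᶠ C : ℝ in atTop, ∀ a L : ℕ, ‖∑ n ∈ range L, u (a + n)‖ ≤ ε * L + C := by
  obtain ⟨C₀, hC₀⟩ := hu ε hε
  filter_upwards [eventually_ge_atTop C₀] with C hC a L
  linarith [hC₀ a L]

lemma comp_add_right (hu : HasUniformMeanZero u) (k : ℕ) :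
    HasUniformMeanZero fun n => u (n + k) := by
  intro ε hε
  obtain ⟨C, hC⟩ := hu ε hε
  refine ⟨C, fun a L => ?_⟩
  simpa only [add_right_comm] using hC (a + k) L

protected lemma star (hu : HasUniformMeanZero u) : HasUniformMeanZero fun n => conj (u n) := by
  simpa only [HasUniformMeanZero, ← map_sum, RCLike.norm_conj] using hu

end HasUniformMeanZero

lemma norm_mul_le_one {z w : ℂ} (hz : ‖z‖ ≤ 1) (hw : ‖w‖ ≤ 1) : ‖z * w‖ ≤ 1 := by
  rw [norm_mul]
  exact mul_le_one₀ hz (norm_nonneg w) hw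

lemma norm_sum_le_card {ι : Type*} {s : Finset ι} {f : ι → ℂ} (hf : ∀ i ∈ s, ‖f i‖ ≤ 1) :
    ‖∑ i ∈ s, f i‖ ≤ #s := by
  simpa using norm_sum_le_of_le s hf

section CauchySchwarz

variable {ι κ : Type*} (s : Finset ι) (t : Finset κ)

theorem sum_norm_sum_sq_le (g : κ → ι → ℂ) :
    ∑ n ∈ s, ‖∑ k ∈ t, g k n‖ ^ 2 ≤ ∑ k ∈ t, ∑ l ∈ t, ‖∑ n ∈ s, g k n * conj (g l n)‖ := by
  have expand : ((∑ n ∈ s, ‖∑ k ∈ t, g k n‖ ^ 2 : ℝ) : ℂ) =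
      ∑ k ∈ t, ∑ l ∈ t, ∑ n ∈ s, g k n * conj (g l n) := by
    simp only [Complex.ofReal_sum, Complex.ofReal_pow, ← Complex.mul_conj', map_sum,
      sum_mul_sum]
    rw [sum_comm]
    exact sum_congr rfl fun k _ => sum_comm
  calc ∑ n ∈ s, ‖∑ k ∈ t, g k n‖ ^ 2
      = ‖((∑ n ∈ s, ‖∑ k ∈ t, g k n‖ ^ 2 : ℝ) : ℂ)‖ := by
        rw [Complex.norm_real, Real.norm_of_nonneg (by positivity)]
    _ ≤ _ := by
        rw [expand]
        exact norm_sum_le_of_le _ fun k _ => norm_sum_le _ _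

lemma sum_sum_le_of_diag_of_offDiag {c B : κ → κ → ℝ} {D : κ → ℝ}
    (hdiag : ∀ k ∈ t, c k k ≤ D k + B k k)
    (hoff : ∀ k ∈ t, ∀ l ∈ t, k ≠ l → c k l ≤ B k l) :
    ∑ k ∈ t, ∑ l ∈ t, c k l ≤ ∑ k ∈ t, D k + ∑ k ∈ t, ∑ l ∈ t, B k l := by
  classical
  rw [← sum_add_distrib]
  refine sum_le_sum fun k hk => ?_
  calc ∑ l ∈ t, c k l
      ≤ ∑ l ∈ t, ((if k = l then D k else 0) + B k l) := sum_le_sum fun l hl => by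
        split_ifs with h
        · exact h ▸ hdiag k hk
        · simpa using hoff k hk l hl h
    _ = D k + ∑ l ∈ t, B k l := by rw [sum_add_distrib, sum_ite_eq, if_pos hk]

theorem sq_sum_norm_sum_le_of_almost_orthogonal {g : κ → ι → ℂ} {D : κ → ℝ} {B : ℝ} (hB : 0 ≤ B)
    (hdiag : ∀ k ∈ t, ∑ n ∈ s, ‖g k n‖ ^ 2 ≤ D k)
    (hoff : ∀ k ∈ t, ∀ l ∈ t, k ≠ l → ‖∑ n ∈ s, g k n * conj (g l n)‖ ≤ B) :
    (∑ n ∈ s, ‖∑ k ∈ t, g k n‖) ^ 2 ≤ #s * (∑ k ∈ t, D k + #t ^ 2 * B) := by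
  refine sq_sum_le_card_mul_sum_sq.trans ?_
  gcongr
  refine (sum_norm_sum_sq_le s t g).trans ?_
  refine (sum_sum_le_of_diag_of_offDiag t (D := D) (B := fun _ _ => B) (fun k hk => ?_)
    hoff).trans_eq ?_
  · have hself : ‖∑ n ∈ s, g k n * conj (g k n)‖ ≤ ∑ n ∈ s, ‖g k n‖ ^ 2 :=
      norm_sum_le_of_le s fun n _ => by rw [norm_mul, RCLike.norm_conj, sq]
    linarith [hdiag k hk]
  · simp only [sum_const, nsmul_eq_mul]
    ring

end CauchySchwarz

section VanDerCorput

variable {u : ℕ → ℂ}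

lemma norm_sum_range_sub_sum_range_shift_le (hu : ∀ n, ‖u n‖ ≤ 1) (L k : ℕ) :
    ‖∑ n ∈ range L, u n - ∑ n ∈ range L, u (n + k)‖ ≤ 2 * k := by
  have overlap : ∑ n ∈ range L, u n + ∑ n ∈ range k, u (L + n) =
      ∑ n ∈ range k, u n + ∑ n ∈ range L, u (n + k) := by
    rw [← sum_range_add, add_comm L k, sum_range_add]
    simp only [add_comm]
  have boundary : ∑ n ∈ range L, u n - ∑ n ∈ range L, u (n + k) =
      ∑ n ∈ range k, u n - ∑ n ∈ range k, u (L + n) := by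
    linear_combination overlap
  have hstart : ‖∑ n ∈ range k, u n‖ ≤ k := by
    simpa using norm_sum_le_card (s := range k) fun n _ => hu n
  have hend : ‖∑ n ∈ range k, u (L + n)‖ ≤ k := by
    simpa using norm_sum_le_card (s := range k) fun n _ => hu (L + n)
  rw [boundary]
  linarith [norm_sub_le (∑ n ∈ range k, u n) (∑ n ∈ range k, u (L + n))]

lemma mul_norm_sum_range_le (hu : ∀ n, ‖u n‖ ≤ 1) (L K : ℕ) :
    K * ‖∑ n ∈ range L, u n‖ ≤ ∑ n ∈ range L, ‖∑ k ∈ range K, u (n + k)‖ + 2 * K ^ 2 := by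
  have average : (K : ℂ) * ∑ n ∈ range L, u n = ∑ n ∈ range L, ∑ k ∈ range K, u (n + k) +
      ∑ k ∈ range K, (∑ n ∈ range L, u n - ∑ n ∈ range L, u (n + k)) := by
    rw [sum_comm, ← sum_add_distrib]
    simp
  have hshift : ‖∑ k ∈ range K, (∑ n ∈ range L, u n - ∑ n ∈ range L, u (n + k))‖ ≤ 2 * K ^ 2 := by
    calc _ ≤ ∑ k ∈ range K, 2 * (K : ℝ) := norm_sum_le_of_le _ fun k hk => by
          refine (norm_sum_range_sub_sum_range_shift_le hu L k).trans ?_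
          gcongr
          exact (mem_range.1 hk).le
      _ = 2 * K ^ 2 := by simp only [sum_const, card_range, nsmul_eq_mul]; ring
  calc (K : ℝ) * ‖∑ n ∈ range L, u n‖
      = ‖(K : ℂ) * ∑ n ∈ range L, u n‖ := by rw [norm_mul, Complex.norm_natCast]
    _ ≤ _ := by
        rw [average]
        exact (norm_add_le _ _).trans (add_le_add (norm_sum_le _ _) hshift)

lemma HasUniformMeanZero.mul_conj_of_ne
    (h : ∀ k ≠ 0, HasUniformMeanZero fun n => u (n + k) * conj (u n)) {k l : ℕ} (hkl : k ≠ l) :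
    HasUniformMeanZero fun n => u (n + k) * conj (u (n + l)) := by
  rcases hkl.lt_or_gt with hlt | hlt
  · obtain ⟨j, rfl⟩ := Nat.exists_eq_add_of_lt hlt
    simpa [mul_comm, add_assoc] using ((h (j + 1) j.succ_ne_zero).comp_add_right k).star
  · obtain ⟨j, rfl⟩ := Nat.exists_eq_add_of_lt hlt
    simpa [add_assoc] using (h (j + 1) j.succ_ne_zero).comp_add_right l

theorem HasUniformMeanZero.of_mul_conj (hu : ∀ n, ‖u n‖ ≤ 1)
    (h : ∀ k ≠ 0, HasUniformMeanZero fun n => u (n + k) * conj (u n)) :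
    HasUniformMeanZero u := by
  intro ε hε
  obtain ⟨K, hK⟩ := exists_nat_gt (2 / ε ^ 2)
  have hK0 : (0 : ℝ) < K := lt_trans (by positivity) hK
  have hKε : 2 ≤ K * ε ^ 2 := ((div_lt_iff₀ (by positivity)).1 hK).le
  have hcorr : ∀ᶠ C : ℝ in atTop, ∀ k ∈ range K, ∀ l ∈ range K, k ≠ l → ∀ a L : ℕ,
      ‖∑ n ∈ range L, u (a + n + k) * conj (u (a + n + l))‖ ≤ 1 / K * L + C := by
    simp only [eventually_all_finset, eventually_imp_distrib_left]
    exact fun k _ l _ hkl => (mul_conj_of_ne h hkl).eventually_le (by positivity)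
  obtain ⟨C, hC, hC0⟩ := (hcorr.and (eventually_ge_atTop 0)).exists
  refine ⟨2 * K + C / (2 * ε), fun a L => ?_⟩
  set T : ℝ := ∑ n ∈ range L, ‖∑ k ∈ range K, u (a + n + k)‖
  have hT_sq : T ^ 2 ≤ L * (K * L + K ^ 2 * (1 / K * L + C)) := by
    have := sq_sum_norm_sum_le_of_almost_orthogonal (range L) (range K)
      (g := fun k n => u (a + n + k)) (D := fun _ => (L : ℝ)) (by positivity)
      (fun k _ => (sum_le_card_nsmul _ _ 1 fun n _ => pow_le_one₀ (norm_nonneg _) (hu _)).trans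
        (by simp)) fun k hk l hl hkl => hC k hk l hl hkl a L
    simpa using this
  have hT : T ≤ K * (ε * L + C / (2 * ε)) := by
    refine (abs_le_of_sq_le_sq' (hT_sq.trans ?_) (by positivity)).2
    calc L * (K * L + K ^ 2 * (1 / K * L + C))
        = 2 * (K * L ^ 2) + K ^ 2 * C * L := by field_simp; ring
      _ ≤ K * ε ^ 2 * (K * L ^ 2) + K ^ 2 * C * L := by gcongr
      _ ≤ K * ε ^ 2 * (K * L ^ 2) + K ^ 2 * C * L + (K * C / (2 * ε)) ^ 2 :=
        le_add_of_nonneg_right (sq_nonneg _)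
      _ = (K * (ε * L + C / (2 * ε))) ^ 2 := by field_simp; ring
  refine le_of_mul_le_mul_left ?_ hK0
  have := mul_norm_sum_range_le (u := fun n => u (a + n)) (fun n => hu _) L K
  simp only [← add_assoc] at this
  linarith

end VanDerCorput

section Weyl

lemma fourierChar_mul_conj (x y : ℝ) : (𝐞 x : ℂ) * conj (𝐞 y : ℂ) = 𝐞 (x - y) := by
  rw [← Circle.coe_inv_eq_conj, ← Circle.coe_mul, ← div_eq_mul_inv, AddChar.map_sub_eq_div]

lemma fourierChar_ne_one_of_irrational {c : ℝ} (hc : Irrational c) : (𝐞 c : ℂ) ≠ 1 := by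
  intro h
  rw [Real.fourierChar_apply] at h
  obtain ⟨n, hn⟩ := Complex.exp_eq_one_iff.1 h
  refine hc.ne_int n ?_
  have : (c : ℂ) = n := mul_left_cancel₀ Complex.two_pi_I_ne_zero <| by
    push_cast at hn
    linear_combination hn
  exact_mod_cast this

lemma hasUniformMeanZero_mul_pow {z w : ℂ} (hz : ‖z‖ ≤ 1) (hz1 : z ≠ 1) :
    HasUniformMeanZero fun n => w * z ^ n := by
  intro ε hε
  refine ⟨‖w‖ * (2 / ‖z - 1‖), fun a L => ?_⟩
  have hgeom : ∑ n ∈ range L, w * z ^ (a + n) = w * z ^ a * ((z ^ L - 1) / (z - 1)) := by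
    rw [← geom_sum_eq hz1, mul_sum]
    exact sum_congr rfl fun n _ => by ring
  have hnum : ‖z ^ L - 1‖ ≤ 2 := by
    have hpow : ‖z ^ L‖ ≤ 1 := by simpa using pow_le_one₀ (norm_nonneg z) hz
    linarith [norm_sub_le (z ^ L) 1, norm_one (α := ℂ)]
  calc ‖∑ n ∈ range L, w * z ^ (a + n)‖
      = ‖w‖ * ‖z‖ ^ a * (‖z ^ L - 1‖ / ‖z - 1‖) := by
        rw [hgeom, norm_mul, norm_mul, norm_pow, norm_div]
    _ ≤ ‖w‖ * 1 * (2 / ‖z - 1‖) := by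
        gcongr
        exact pow_le_one₀ (norm_nonneg z) hz
    _ ≤ ε * L + ‖w‖ * (2 / ‖z - 1‖) := by
        rw [mul_one]
        exact le_add_of_nonneg_left (by positivity)

lemma eq_add_mul_of_fwdDiff_eq_const {f : ℕ → ℝ} {c : ℝ} (hf : ∀ n, fwdDiff 1 f n = c) (n : ℕ) :
    f n = f 0 + n * c := by
  induction n with
  | zero => simp
  | succ n ih =>
    have hstep : f (n + 1) - f n = c := hf n
    push_cast
    linarith

lemma fwdDiff_iter_shift_sub_self {f : ℕ → ℝ} {c : ℝ} {d : ℕ}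
    (hf : ∀ n, (fwdDiff 1)^[d + 1] f n = c) (k n : ℕ) :
    (fwdDiff 1)^[d] (fun m => f (m + k) - f m) n = k * c := by
  have hlin (m : ℕ) : (fwdDiff 1)^[d] f m = (fwdDiff 1)^[d] f 0 + m * c :=
    eq_add_mul_of_fwdDiff_eq_const (fun i => by rw [← hf i, Function.iterate_succ_apply']) m
  have hsub : (fwdDiff 1)^[d] (fun m => f (m + k) - f m) n =
      (fwdDiff 1)^[d] (fun m => f (m + k)) n - (fwdDiff 1)^[d] f n := by
    simp only [fwdDiff_iter_eq_sum_shift, smul_sub, sum_sub_distrib]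
  rw [hsub, fwdDiff_iter_comp_add, hlin (n + k), hlin n]
  push_cast
  ring

theorem hasUniformMeanZero_fourierChar_of_fwdDiff_iter {d : ℕ} {f : ℕ → ℝ} {c : ℝ}
    (hc : Irrational c) (hf : ∀ n, (fwdDiff 1)^[d + 1] f n = c) :
    HasUniformMeanZero fun n => (𝐞 (f n) : ℂ) := by
  induction d generalizing f c with
  | zero =>
    have hlinear (n : ℕ) : (𝐞 (f n) : ℂ) = 𝐞 (f 0) * (𝐞 c : ℂ) ^ n := by
      rw [eq_add_mul_of_fwdDiff_eq_const hf n, AddChar.map_add_eq_mul, ← nsmul_eq_mul,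
        AddChar.map_nsmul_eq_pow, Circle.coe_mul, Circle.coe_pow]
    rw [funext hlinear]
    exact hasUniformMeanZero_mul_pow (Circle.norm_coe _).le (fourierChar_ne_one_of_irrational hc)
  | succ d ih =>
    refine .of_mul_conj (fun n => (Circle.norm_coe _).le) fun k hk => ?_
    simp only [fourierChar_mul_conj]
    exact ih (hc.natCast_mul hk) (fwdDiff_iter_shift_sub_self hf k)

theorem hasUniformMeanZero_fourierChar_eval {P : Polynomial ℝ} (hP : P.natDegree ≠ 0)
    (hP_irr : Irrational P.leadingCoeff) :
    HasUniformMeanZero fun n => (𝐞 (P.eval (n : ℝ)) : ℂ) := by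
  obtain ⟨d, hd⟩ := Nat.exists_eq_succ_of_ne_zero hP
  refine hasUniformMeanZero_fourierChar_of_fwdDiff_iter (d := d)
    (hP_irr.mul_natCast P.natDegree.factorial_ne_zero) fun n => ?_
  have htop := congrFun P.fwdDiff_iter_degree_eq_factorial (n : ℝ)
  rw [hd, fwdDiff_iter_eq_sum_shift] at htop
  rw [fwdDiff_iter_eq_sum_shift]
  simpa [hd] using htop

theorem hasUniformMeanZero_fourierChar_eval_dilates {P : Polynomial ℝ} (hP : P.natDegree ≠ 0)
    (hP_irr : Irrational P.leadingCoeff) {p q : ℕ} (hpq : p ≠ q) :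
    HasUniformMeanZero fun m =>
      (𝐞 (P.eval ((p * m : ℕ) : ℝ)) : ℂ) * conj (𝐞 (P.eval ((q * m : ℕ) : ℝ)) : ℂ) := by
  set d := P.natDegree
  let Q : Polynomial ℝ :=
    P.comp (Polynomial.C (p : ℝ) * Polynomial.X) - P.comp (Polynomial.C (q : ℝ) * Polynomial.X)
  have hdilate (r : ℕ) : (P.comp (Polynomial.C (r : ℝ) * Polynomial.X)).natDegree ≤ d := by
    refine Polynomial.natDegree_comp_le.trans (mul_le_of_le_one_right d.zero_le ?_)
    exact (Polynomial.natDegree_C_mul_le _ _).trans Polynomial.natDegree_X_le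
  have hcoeff : Q.coeff d = ((p ^ d - q ^ d : ℤ) : ℝ) * P.leadingCoeff := by
    simp only [Q, Polynomial.coeff_sub, Polynomial.comp_C_mul_X_coeff, Polynomial.leadingCoeff, d]
    push_cast
    ring
  have hcoeff_irr : Irrational (Q.coeff d) := by
    refine hcoeff ▸ hP_irr.intCast_mul (sub_ne_zero.2 ?_)
    exact_mod_cast fun h => hpq (Nat.pow_left_injective hP h)
  have hdeg : Q.natDegree = d := Polynomial.natDegree_eq_of_le_of_coeff_ne_zero
    ((Polynomial.natDegree_sub_le _ _).trans (max_le (hdilate p) (hdilate q))) hcoeff_irr.ne_zero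
  have hQ := hasUniformMeanZero_fourierChar_eval (P := Q) (hdeg ▸ hP)
    (by rwa [Polynomial.leadingCoeff, hdeg])
  simp only [fourierChar_mul_conj]
  simpa [Q] using hQ

end Weyl

section StepWeights

lemma exists_filter_eq_Ico_of_monotone {F : ℕ → ℕ} (hF : Monotone F) {N k : ℕ}
    (hne : {n ∈ range N | F n = k}.Nonempty) :
    ∃ a b, F a = k ∧ {n ∈ range N | F n = k} = Ico a b := by
  have hmin := (mem_filter.1 (min'_mem _ hne)).2
  have hmax := mem_filter.1 (max'_mem _ hne)
  refine ⟨_, max' _ hne + 1, hmin, ?_⟩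
  ext n
  rw [mem_Ico, Nat.lt_succ_iff]
  refine ⟨fun hn => ⟨min'_le _ n hn, le_max' _ n hn⟩, fun hn => mem_filter.2 ⟨?_, ?_⟩⟩
  · exact mem_range.2 (hn.2.trans_lt (mem_range.1 hmax.1))
  · exact le_antisymm ((hF hn.2).trans_eq hmax.2) (hmin.ge.trans (hF hn.1))

theorem norm_sum_range_mul_le_of_monotone {w u : ℕ → ℂ} {F : ℕ → ℕ} {ε C : ℝ} (hC : 0 ≤ C)
    (hu : ∀ a L : ℕ, ‖∑ n ∈ range L, u (a + n)‖ ≤ ε * L + C) (hw : ∀ n, ‖w n‖ ≤ 1)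
    (hF : Monotone F) (hwF : ∀ m n, F m = F n → w m = w n) (N : ℕ) :
    ‖∑ n ∈ range N, w n * u n‖ ≤ ε * N + C * (F N + 1) := by
  have hmaps : ∀ n ∈ range N, F n ∈ range (F N + 1) := fun n hn =>
    mem_range.2 (Nat.lt_succ_of_le (hF (mem_range.1 hn).le))
  have hfiber (k : ℕ) : ‖∑ n ∈ range N with F n = k, w n * u n‖ ≤
      ε * #{n ∈ range N | F n = k} + C := by
    rcases ({n ∈ range N | F n = k}).eq_empty_or_nonempty with hempty | hne
    · simpa [hempty] using hC
    obtain ⟨a, b, ha, hinterval⟩ := exists_filter_eq_Ico_of_monotone hF hne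
    have hconst : ∑ n ∈ range N with F n = k, w n * u n = w a * ∑ n ∈ range (b - a), u (a + n) := by
      rw [← sum_Ico_eq_sum_range, ← hinterval, mul_sum]
      refine sum_congr rfl fun n hn => ?_
      rw [hwF n a ((mem_filter.1 hn).2.trans ha.symm)]
    rw [hconst, norm_mul, hinterval, Nat.card_Ico]
    exact (mul_le_of_le_one_left (norm_nonneg _) (hw a)).trans (hu a _)
  calc ‖∑ n ∈ range N, w n * u n‖
      = ‖∑ k ∈ range (F N + 1), ∑ n ∈ range N with F n = k, w n * u n‖ := by
        rw [sum_fiberwise_of_maps_to hmaps]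
    _ ≤ ∑ k ∈ range (F N + 1), (ε * #{n ∈ range N | F n = k} + C) :=
        norm_sum_le_of_le _ fun k _ => hfiber k
    _ = ε * N + C * (F N + 1) := by
        rw [sum_add_distrib, ← mul_sum, ← Nat.cast_sum, ← card_eq_sum_card_fiberwise hmaps]
        simp [mul_comm]

variable {ι : Type*} {T : Finset ι} {l r : ι → ℕ} {c : ι → ℂ}

/-- The number of endpoints of the intervals `[l t, r t)`, `t ∈ T`, that do not exceed `n`. Two
points at which it agrees lie in the same intervals of the family. -/
def endpointCount (T : Finset ι) (l r : ι → ℕ) (n : ℕ) : ℕ :=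
  #{t ∈ T | l t ≤ n} + #{t ∈ T | r t ≤ n}

/-- The function equal to `c t` on the interval `[l t, r t)` for each `t ∈ T`, and to zero off
these intervals. Values on overlapping intervals add up. -/
def stepFunction (T : Finset ι) (l r : ι → ℕ) (c : ι → ℂ) (n : ℕ) : ℂ :=
  ∑ t ∈ T with n ∈ Ico (l t) (r t), c t

lemma endpointCount_mono : Monotone (endpointCount T l r) := fun _ _ h =>
  add_le_add (card_le_card (monotone_filter_right T fun _ _ ht => ht.trans h))
    (card_le_card (monotone_filter_right T fun _ _ ht => ht.trans h))

lemma endpointCount_le (n : ℕ) : endpointCount T l r n ≤ 2 * #T := by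
  rw [two_mul]
  exact add_le_add (card_filter_le _ _) (card_filter_le _ _)

lemma mem_Ico_iff_of_endpointCount_eq {m n : ℕ} (h : endpointCount T l r m = endpointCount T l r n)
    {t : ι} (ht : t ∈ T) : m ∈ Ico (l t) (r t) ↔ n ∈ Ico (l t) (r t) := by
  wlog hmn : m ≤ n generalizing m n
  · exact (this h.symm (le_of_not_ge hmn)).symm
  have hsub (e : ι → ℕ) : {t ∈ T | e t ≤ m} ⊆ {t ∈ T | e t ≤ n} :=
    monotone_filter_right T fun _ _ he => he.trans hmn
  obtain ⟨hl, hr⟩ := (add_eq_add_iff_eq_and_eq (card_le_card (hsub l)) (card_le_card (hsub r))).1 h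
  have hl_iff := filter_inj'.1 (eq_of_subset_of_card_le (hsub l) hl.ge) ht
  have hr_iff := filter_inj'.1 (eq_of_subset_of_card_le (hsub r) hr.ge) ht
  rw [mem_Ico, mem_Ico, hl_iff, ← not_le, ← not_le, hr_iff]

lemma stepFunction_congr {m n : ℕ} (h : endpointCount T l r m = endpointCount T l r n) :
    stepFunction T l r c m = stepFunction T l r c n := by
  rw [stepFunction, filter_congr fun t ht => mem_Ico_iff_of_endpointCount_eq h ht, stepFunction]

lemma norm_stepFunction_le (hdisj : (T : Set ι).PairwiseDisjoint fun t => Ico (l t) (r t))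
    (hc : ∀ t, ‖c t‖ ≤ 1) (n : ℕ) : ‖stepFunction T l r c n‖ ≤ 1 := by
  refine (norm_sum_le_card fun t _ => hc t).trans ?_
  refine Nat.cast_le_one.2 (card_le_one.2 fun t ht t' ht' => ?_)
  rw [mem_filter] at ht ht'
  exact hdisj.elim_finset ht.1 ht'.1 n ht.2 ht'.2

lemma stepFunction_eq_zero {N n : ℕ} (hr : ∀ t ∈ T, r t ≤ N) (hn : N ≤ n) :
    stepFunction T l r c n = 0 := by
  rw [stepFunction, filter_eq_empty_iff.2, sum_empty]
  intro t ht hmem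
  exact ((mem_Ico.1 hmem).2.trans_le (hr t ht)).not_ge hn

lemma sum_range_stepFunction_mul {N : ℕ} (hr : ∀ t ∈ T, r t ≤ N) (g : ℕ → ℂ) :
    ∑ n ∈ range N, stepFunction T l r c n * g n = ∑ t ∈ T, c t * ∑ n ∈ Ico (l t) (r t), g n := by
  simp only [stepFunction, sum_mul, mul_sum]
  refine sum_comm' fun n t => ?_
  simp only [mem_filter, mem_range, mem_Ico]
  exact ⟨fun h => ⟨h.2.2, h.2.1⟩, fun h => ⟨h.1.2.trans_le (hr t h.2), h.2, h.1⟩⟩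

theorem norm_sum_range_stepFunction_correlation_le
    (hdisj : (T : Set ι).PairwiseDisjoint fun t => Ico (l t) (r t)) (hc : ∀ t, ‖c t‖ ≤ 1)
    {u : ℕ → ℂ} {p q : ℕ} {ε C : ℝ} (hC : 0 ≤ C)
    (hu : ∀ a L : ℕ, ‖∑ m ∈ range L, u (p * (a + m)) * conj (u (q * (a + m)))‖ ≤ ε * L + C)
    (N : ℕ) :
    ‖∑ m ∈ range N, stepFunction T l r c (p * m) * u (p * m) *
        conj (stepFunction T l r c (q * m) * u (q * m))‖ ≤ ε * N + C * (4 * #T + 1) := by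
  set W := stepFunction T l r c
  set F : ℕ → ℕ := fun m => endpointCount T l r (p * m) + endpointCount T l r (q * m)
  have hmono (k : ℕ) : Monotone fun m => endpointCount T l r (k * m) := fun m n h =>
    endpointCount_mono (Nat.mul_le_mul_left k h)
  have hW_const (m n : ℕ) (h : F m = F n) :
      W (p * m) * conj (W (q * m)) = W (p * n) * conj (W (q * n)) := by
    wlog hmn : m ≤ n generalizing m n
    · exact (this n m h.symm (le_of_not_ge hmn)).symm
    obtain ⟨hp, hq⟩ := (add_eq_add_iff_eq_and_eq (hmono p hmn) (hmono q hmn)).1 h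
    exact congrArg₂ (fun z w => z * conj w) (stepFunction_congr hp) (stepFunction_congr hq)
  have hW_norm (m : ℕ) : ‖W (p * m) * conj (W (q * m))‖ ≤ 1 :=
    norm_mul_le_one (norm_stepFunction_le hdisj hc _)
      ((RCLike.norm_conj _).trans_le (norm_stepFunction_le hdisj hc _))
  have hF_le : (F N : ℝ) ≤ 4 * #T := by
    have := add_le_add (endpointCount_le (T := T) (l := l) (r := r) (p * N))
      (endpointCount_le (T := T) (l := l) (r := r) (q * N))
    exact_mod_cast this.trans (by lia)
  calc _ = ‖∑ m ∈ range N, W (p * m) * conj (W (q * m)) * (u (p * m) * conj (u (q * m)))‖ := by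
        simp only [map_mul, mul_mul_mul_comm]
    _ ≤ ε * N + C * (F N + 1) := norm_sum_range_mul_le_of_monotone hC hu hW_norm
        ((hmono p).add (hmono q)) hW_const N
    _ ≤ _ := by gcongr

end StepWeights

section Multiples

lemma sum_range_filter_dvd {E : Type*} [AddCommMonoid E] {d : ℕ} (hd : d ≠ 0) (N : ℕ) (g : ℕ → E) :
    ∑ n ∈ range N with d ∣ n, g n = ∑ m ∈ range N with d * m < N, g (d * m) := by
  have himage : {n ∈ range N | d ∣ n} = {m ∈ range N | d * m < N}.image (d * ·) := by
    ext n
    simp only [mem_filter, mem_range, mem_image]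
    constructor
    · rintro ⟨hn, m, rfl⟩
      exact ⟨m, ⟨(Nat.le_mul_of_pos_left m hd.bot_lt).trans_lt hn, hn⟩, rfl⟩
    · rintro ⟨m, ⟨-, hm⟩, rfl⟩
      exact ⟨hm, dvd_mul_right d m⟩
  rw [himage, sum_image fun _ _ _ _ h => Nat.eq_of_mul_eq_mul_left hd.bot_lt h]

lemma sum_range_filter_dvd_of_eq_zero {E : Type*} [AddCommMonoid E] {d N : ℕ} (hd : d ≠ 0)
    {g : ℕ → E} (hg : ∀ n, N ≤ n → g n = 0) :
    ∑ n ∈ range N with d ∣ n, g n = ∑ m ∈ range N, g (d * m) := by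
  rw [sum_range_filter_dvd hd]
  exact sum_filter_of_ne fun m _ hm => not_le.1 fun h => hm (hg _ h)

lemma card_range_filter_mul_lt {d : ℕ} (hd : d ≠ 0) (N : ℕ) :
    #{m ∈ range N | d * m < N} = #{n ∈ range N | d ∣ n} := by
  simpa only [card_eq_sum_ones] using (sum_range_filter_dvd hd N fun _ => 1).symm

lemma card_range_filter_dvd_eq_ceil {d : ℕ} (hd : d ≠ 0) (N : ℕ) :
    (#{n ∈ range N | d ∣ n} : ℤ) = ⌈(N : ℝ) / d⌉ := by
  have hcast : (N : ℝ) / d = ((N / d : ℚ) : ℝ) := by push_cast; rfl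
  rw [hcast, Rat.ceil_cast]
  simpa [Nat.count_eq_card_filter_range, Nat.modEq_zero_iff_dvd] using
    N.count_modEq_card_eq_ceil hd.bot_lt 0

lemma div_le_card_range_filter_dvd {d : ℕ} (hd : d ≠ 0) (N : ℕ) :
    (N : ℝ) / d ≤ #{n ∈ range N | d ∣ n} := by
  simpa only [← card_range_filter_dvd_eq_ceil hd, Int.cast_natCast] using Int.le_ceil ((N : ℝ) / d)

lemma card_range_filter_dvd_le {d : ℕ} (hd : d ≠ 0) (N : ℕ) :
    (#{n ∈ range N | d ∣ n} : ℝ) ≤ N / d + 1 := by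
  simpa only [← card_range_filter_dvd_eq_ceil hd, Int.cast_natCast] using
    (Int.ceil_lt_add_one ((N : ℝ) / d)).le

end Multiples

section TuranKubilius

variable {S : Finset ℕ}

/-- The number of elements of `S` dividing `n`; for `S` a set of primes this is the truncation
`ω_S` of the prime divisor counting function. -/
def divisorCountIn (S : Finset ℕ) (n : ℕ) : ℕ := #{d ∈ S | d ∣ n}

lemma sum_range_divisorCountIn_mul {N : ℕ} (hS : ∀ d ∈ S, d ≠ 0) {g : ℕ → ℂ}
    (hg : ∀ n, N ≤ n → g n = 0) :
    ∑ n ∈ range N, (divisorCountIn S n : ℂ) * g n = ∑ d ∈ S, ∑ m ∈ range N, g (d * m) := by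
  simp only [divisorCountIn, natCast_card_filter, sum_mul, ite_mul, one_mul, zero_mul]
  rw [sum_comm]
  refine sum_congr rfl fun d hd => ?_
  rw [← sum_filter, sum_range_filter_dvd_of_eq_zero (hS d hd) hg]

lemma mul_sum_one_div_le_sum_divisorCountIn (hS : ∀ d ∈ S, d ≠ 0) (N : ℕ) :
    N * ∑ d ∈ S, (1 : ℝ) / d ≤ ∑ n ∈ range N, (divisorCountIn S n : ℝ) := by
  simp only [divisorCountIn, natCast_card_filter]
  rw [sum_comm, mul_sum]
  refine sum_le_sum fun d hd => ?_
  rw [mul_one_div, ← natCast_card_filter]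
  exact div_le_card_range_filter_dvd (hS d hd) N

lemma sum_divisorCountIn_sq_le (hS : ∀ d ∈ S, d ≠ 0) (hcop : (S : Set ℕ).Pairwise Nat.Coprime)
    (N : ℕ) :
    ∑ n ∈ range N, (divisorCountIn S n : ℝ) ^ 2 ≤
      N * ∑ d ∈ S, (1 : ℝ) / d + (N * (∑ d ∈ S, (1 : ℝ) / d) ^ 2 + (#S : ℝ) ^ 2) := by
  have hexpand : ∑ n ∈ range N, (divisorCountIn S n : ℝ) ^ 2 =
      ∑ d ∈ S, ∑ e ∈ S, (#{n ∈ range N | d ∣ n ∧ e ∣ n} : ℝ) := by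
    simp only [divisorCountIn, natCast_card_filter, sq, sum_mul_sum, ite_zero_mul_ite_zero, mul_one]
    rw [sum_comm]
    exact sum_congr rfl fun d _ => sum_comm
  rw [hexpand]
  refine (sum_sum_le_of_diag_of_offDiag S (D := fun d => N * ((1 : ℝ) / d))
    (B := fun d e => N * ((1 : ℝ) / d * (1 / e)) + 1) (fun d hd => ?_)
    fun d hd e he hde => ?_).trans_eq ?_
  · have hpos : (0 : ℝ) ≤ N * (1 / d * (1 / d)) := by positivity
    have hcard := card_range_filter_dvd_le (hS d hd) N
    simp only [and_self, mul_one_div (N : ℝ) (d : ℝ)]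
    linarith
  · have hcard := card_range_filter_dvd_le (mul_ne_zero (hS d hd) (hS e he)) N
    simp only [← Nat.lcm_dvd_iff, Nat.Coprime.lcm_eq_mul (hcop hd he hde)]
    refine hcard.trans_eq ?_
    rw [one_div_mul_one_div, mul_one_div, Nat.cast_mul]
  · simp only [sum_add_distrib, ← mul_sum, ← sum_mul, sum_const, nsmul_eq_mul, mul_one]
    ring

theorem turan_kubilius (hS : ∀ d ∈ S, d ≠ 0) (hcop : (S : Set ℕ).Pairwise Nat.Coprime) (N : ℕ) :
    ∑ n ∈ range N, (∑ d ∈ S, (1 : ℝ) / d - divisorCountIn S n) ^ 2 ≤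
      N * ∑ d ∈ S, (1 : ℝ) / d + (#S : ℝ) ^ 2 := by
  set A : ℝ := ∑ d ∈ S, (1 : ℝ) / d
  have hA : 0 ≤ A := by positivity
  have hfirst := mul_le_mul_of_nonneg_left (mul_sum_one_div_le_sum_divisorCountIn hS N) hA
  have hsecond := sum_divisorCountIn_sq_le hS hcop N
  calc ∑ n ∈ range N, (A - divisorCountIn S n) ^ 2
      = N * A ^ 2 - 2 * (A * ∑ n ∈ range N, (divisorCountIn S n : ℝ)) +
          ∑ n ∈ range N, (divisorCountIn S n : ℝ) ^ 2 := by
        simp only [sub_sq, sum_add_distrib, sum_sub_distrib, sum_const, card_range, nsmul_eq_mul,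
          mul_assoc, ← mul_sum]
    _ ≤ N * A + (#S : ℝ) ^ 2 := by linarith

theorem sum_abs_sub_divisorCountIn_le (hS : ∀ d ∈ S, d ≠ 0)
    (hcop : (S : Set ℕ).Pairwise Nat.Coprime) (hA : 1 ≤ ∑ d ∈ S, (1 : ℝ) / d) {N : ℕ}
    (hSN : #S ^ 2 ≤ N) :
    ∑ n ∈ range N, |∑ d ∈ S, (1 : ℝ) / d - divisorCountIn S n| ≤
      2 * √(∑ d ∈ S, (1 : ℝ) / d) * N := by
  have hTK := turan_kubilius hS hcop N
  set A : ℝ := ∑ d ∈ S, (1 : ℝ) / d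
  have hcard : (#S : ℝ) ^ 2 ≤ N := mod_cast hSN
  have hNA : (N : ℝ) ≤ N * A := le_mul_of_one_le_right N.cast_nonneg hA
  refine (abs_le_of_sq_le_sq' ?_ (by positivity)).2
  calc (∑ n ∈ range N, |A - divisorCountIn S n|) ^ 2
      ≤ N * ∑ n ∈ range N, (A - divisorCountIn S n) ^ 2 := by
        simpa only [sq_abs, card_range] using sq_sum_le_card_mul_sum_sq (s := range N)
          (f := fun n => |A - divisorCountIn S n|)
    _ ≤ N * (4 * (N * A)) := by
        gcongr
        linarith
    _ = (2 * √A * N) ^ 2 := by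
        rw [mul_pow, mul_pow, Real.sq_sqrt (by linarith)]
        ring

end TuranKubilius

section Katai

variable {a ν : ℕ → ℂ} {N : ℕ} {S : Finset ℕ}

lemma sum_one_div_sq_le_one (hS : ∀ d ∈ S, 1 < d) : ∑ d ∈ S, (1 : ℝ) / (d ^ 2 : ℕ) ≤ 1 := by
  have hsub : S ⊆ Ioo 1 (S.sup id + 1) := fun d hd =>
    mem_Ioo.2 ⟨hS d hd, Nat.lt_succ_of_le (le_sup (f := id) hd)⟩
  calc ∑ d ∈ S, (1 : ℝ) / (d ^ 2 : ℕ)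
      ≤ ∑ d ∈ Ioo 1 (S.sup id + 1), (1 : ℝ) / (d ^ 2 : ℕ) :=
        sum_le_sum_of_subset_of_nonneg hsub fun _ _ _ => by positivity
    _ = ∑ d ∈ Ioo 1 (S.sup id + 1), ((d : ℝ) ^ 2)⁻¹ := by simp
    _ ≤ 1 := (sum_Ioo_inv_sq_le _ _).trans (by norm_num)

lemma exists_primes_sum_one_div_gt (R : ℝ) :
    ∃ S : Finset ℕ, (∀ p ∈ S, p.Prime) ∧ R < ∑ p ∈ S, (1 : ℝ) / p := by
  have hdiv := (not_summable_iff_tendsto_nat_atTop_of_nonneg fun n =>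
    Set.indicator_nonneg (fun _ _ => by positivity) n).1 not_summable_one_div_on_primes
  obtain ⟨n, hn⟩ := (hdiv.eventually_gt_atTop R).exists
  refine ⟨{p ∈ range n | p.Prime}, fun p hp => (mem_filter.1 hp).2, ?_⟩
  rw [sum_filter]
  simpa [Set.indicator_apply] using hn

lemma sum_one_div_mul_sum_eq (hS : ∀ p ∈ S, p ≠ 0) (ha₀ : ∀ n, N ≤ n → a n = 0) :
    (∑ p ∈ S, (1 : ℝ) / p : ℝ) * ∑ n ∈ range N, a n * ν n =
      ∑ n ∈ range N, ((∑ p ∈ S, (1 : ℝ) / p - divisorCountIn S n : ℝ) : ℂ) * (a n * ν n) +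
        (∑ m ∈ range N, ν m * ∑ p ∈ S, ν p * a (p * m) +
          ∑ p ∈ S, ∑ m ∈ range N, a (p * m) * (ν (p * m) - ν p * ν m)) := by
  have hswap : ∑ m ∈ range N, ν m * ∑ p ∈ S, ν p * a (p * m) =
      ∑ p ∈ S, ∑ m ∈ range N, a (p * m) * (ν p * ν m) := by
    simp only [mul_sum]
    rw [sum_comm]
    exact sum_congr rfl fun p _ => sum_congr rfl fun m _ => by ring
  have hcount := sum_range_divisorCountIn_mul hS (g := fun n => a n * ν n)
    fun n hn => by rw [ha₀ n hn, zero_mul]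
  simp only [Complex.ofReal_sub, Complex.ofReal_natCast, sub_mul, mul_sub, sum_sub_distrib, hswap,
    hcount, ← mul_sum]
  ring

lemma norm_sum_mul_defect_le {ν : ArithmeticFunction ℂ} (hν : ν.IsMultiplicative)
    (hν₁ : ∀ n, ‖ν n‖ ≤ 1) (ha₁ : ∀ n, ‖a n‖ ≤ 1) (ha₀ : ∀ n, N ≤ n → a n = 0) {p : ℕ}
    (hp : p.Prime) :
    ‖∑ m ∈ range N, a (p * m) * (ν (p * m) - ν p * ν m)‖ ≤ 2 * (N * (1 / (p ^ 2 : ℕ)) + 1) := by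
  set f : ℕ → ℂ := fun m => a (p * m) * (ν (p * m) - ν p * ν m)
  have hf (m : ℕ) : ‖f m‖ ≤ 2 := by
    have hdefect : ‖ν (p * m) - ν p * ν m‖ ≤ 2 := (norm_sub_le _ _).trans <|
      (add_le_add (hν₁ _) (norm_mul_le_one (hν₁ p) (hν₁ m))).trans_eq one_add_one_eq_two
    rw [norm_mul]
    exact (mul_le_of_le_one_left (norm_nonneg _) (ha₁ _)).trans hdefect
  have hf_supp : ∀ m ∈ range N, f m ≠ 0 → p ∣ m := fun m _ hm => by
    by_contra hdvd
    exact hm <| by simp [f, hν.map_mul_of_coprime ((Nat.Prime.coprime_iff_not_dvd hp).2 hdvd)]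
  have hf_zero (k : ℕ) (hk : N ≤ p ^ 2 * k) : f (p * k) = 0 := by
    simp only [f, ← mul_assoc, ← sq, ha₀ _ hk, zero_mul]
  have hsum : ∑ m ∈ range N, f m = ∑ k ∈ range N with p ^ 2 * k < N, f (p * k) := by
    rw [← sum_filter_of_ne hf_supp, sum_range_filter_dvd_of_eq_zero hp.ne_zero fun n hn => ?_]
    · exact (sum_filter_of_ne fun k _ hk => not_le.1 fun h => hk (hf_zero k h)).symm
    · simp only [f, ha₀ _ (hn.trans (Nat.le_mul_of_pos_left n hp.pos)), zero_mul]
  calc ‖∑ m ∈ range N, f m‖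
      ≤ #{k ∈ range N | p ^ 2 * k < N} * 2 := by
        rw [hsum, ← nsmul_eq_mul]
        exact (norm_sum_le _ _).trans (sum_le_card_nsmul _ _ _ fun k _ => hf _)
    _ ≤ 2 * (N * (1 / (p ^ 2 : ℕ)) + 1) := by
        have hsq : p ^ 2 ≠ 0 := pow_ne_zero 2 hp.ne_zero
        rw [card_range_filter_mul_lt hsq, mul_one_div, mul_comm]
        gcongr
        exact card_range_filter_dvd_le hsq N

lemma norm_sum_sum_mul_defect_le {ν : ArithmeticFunction ℂ} (hν : ν.IsMultiplicative)
    (hν₁ : ∀ n, ‖ν n‖ ≤ 1) (ha₁ : ∀ n, ‖a n‖ ≤ 1) (ha₀ : ∀ n, N ≤ n → a n = 0)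
    (hS : ∀ p ∈ S, p.Prime) (hSN : #S ≤ N) :
    ‖∑ p ∈ S, ∑ m ∈ range N, a (p * m) * (ν (p * m) - ν p * ν m)‖ ≤ 4 * N := by
  have hcard : (#S : ℝ) ≤ N := mod_cast hSN
  calc _ ≤ ∑ p ∈ S, 2 * (N * (1 / (p ^ 2 : ℕ) : ℝ) + 1) := norm_sum_le_of_le _ fun p hp =>
        norm_sum_mul_defect_le hν hν₁ ha₁ ha₀ (hS p hp)
    _ = 2 * (N * ∑ p ∈ S, (1 / (p ^ 2 : ℕ) : ℝ) + #S) := by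
        rw [← mul_sum, sum_add_distrib, ← mul_sum, sum_const, nsmul_eq_mul, mul_one]
    _ ≤ 2 * (N * 1 + N) := by
        gcongr
        exact sum_one_div_sq_le_one fun p hp => (hS p hp).one_lt
    _ = 4 * N := by ring

lemma sum_norm_sum_mul_dilate_le (hν₁ : ∀ n, ‖ν n‖ ≤ 1) (ha₁ : ∀ n, ‖a n‖ ≤ 1)
    (ha₀ : ∀ n, N ≤ n → a n = 0) (hS : ∀ p ∈ S, p ≠ 0) (hSN : #S ≤ N)
    (hA : 1 ≤ ∑ p ∈ S, (1 : ℝ) / p)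
    (hcorr : ∀ p ∈ S, ∀ q ∈ S, p ≠ q →
      ‖∑ m ∈ range N, a (p * m) * conj (a (q * m))‖ ≤ N / (#S : ℝ) ^ 2) :
    ∑ m ∈ range N, ‖∑ p ∈ S, ν p * a (p * m)‖ ≤ 2 * √(∑ p ∈ S, (1 : ℝ) / p) * N := by
  have hdiag : ∀ p ∈ S, ∑ m ∈ range N, ‖ν p * a (p * m)‖ ^ 2 ≤ N * (1 / p : ℝ) + 1 := by
    intro p hp
    rw [← sum_filter_of_ne (p := fun m => p * m < N) fun m _ hm => not_le.1 fun h =>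
      hm (by simp [ha₀ _ h]), mul_one_div]
    refine (sum_le_card_nsmul _ _ 1 fun m _ => pow_le_one₀ (norm_nonneg _)
      (norm_mul_le_one (hν₁ _) (ha₁ _))).trans ?_
    rw [nsmul_one, card_range_filter_mul_lt (hS p hp)]
    exact card_range_filter_dvd_le (hS p hp) N
  have hoff : ∀ p ∈ S, ∀ q ∈ S, p ≠ q →
      ‖∑ m ∈ range N, ν p * a (p * m) * conj (ν q * a (q * m))‖ ≤ N / (#S : ℝ) ^ 2 := by
    intro p hp q hq hpq
    have hfactor : ∑ m ∈ range N, ν p * a (p * m) * conj (ν q * a (q * m)) =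
        ν p * conj (ν q) * ∑ m ∈ range N, a (p * m) * conj (a (q * m)) := by
      simp only [map_mul, mul_mul_mul_comm (ν p), mul_sum]
    rw [hfactor, norm_mul]
    refine (mul_le_of_le_one_left (norm_nonneg _) ?_).trans (hcorr p hp q hq hpq)
    exact norm_mul_le_one (hν₁ p) ((RCLike.norm_conj _).trans_le (hν₁ q))
  have hCS := sq_sum_norm_sum_le_of_almost_orthogonal (range N) S (by positivity) hdiag hoff
  rw [sum_add_distrib, ← mul_sum, sum_const, nsmul_one, card_range] at hCS
  set A : ℝ := ∑ p ∈ S, (1 : ℝ) / p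
  have hcard : (#S : ℝ) ≤ N := mod_cast hSN
  have hNA : (N : ℝ) ≤ N * A := le_mul_of_one_le_right N.cast_nonneg hA
  have hcorr_total : (#S : ℝ) ^ 2 * (N / #S ^ 2) ≤ N := by
    rw [mul_div_left_comm]
    exact mul_le_of_le_one_right N.cast_nonneg (div_self_le_one _)
  refine (abs_le_of_sq_le_sq' (hCS.trans ?_) (by positivity)).2
  calc N * (N * A + #S + #S ^ 2 * (N / #S ^ 2))
      ≤ N * (4 * (N * A)) := by
        gcongr
        linarith
    _ = (2 * √A * N) ^ 2 := by
        rw [mul_pow, mul_pow, Real.sq_sqrt (by linarith)]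
        ring

theorem katai_criterion {ν : ArithmeticFunction ℂ} (hν : ν.IsMultiplicative)
    (hν₁ : ∀ n, ‖ν n‖ ≤ 1) (ha₁ : ∀ n, ‖a n‖ ≤ 1) (ha₀ : ∀ n, N ≤ n → a n = 0)
    (hS : ∀ p ∈ S, p.Prime) (hSN : #S ^ 2 ≤ N) (hA : 1 ≤ ∑ p ∈ S, (1 : ℝ) / p)
    (hcorr : ∀ p ∈ S, ∀ q ∈ S, p ≠ q →
      ‖∑ m ∈ range N, a (p * m) * conj (a (q * m))‖ ≤ N / (#S : ℝ) ^ 2) :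
    √(∑ p ∈ S, (1 : ℝ) / p) * ‖∑ n ∈ range N, a n * ν n‖ ≤ 8 * N := by
  have hS₀ : ∀ p ∈ S, p ≠ 0 := fun p hp => (hS p hp).ne_zero
  have hcop : (S : Set ℕ).Pairwise Nat.Coprime := fun p hp q hq hpq =>
    (Nat.coprime_primes (hS p hp) (hS q hq)).2 hpq
  have hSN' : #S ≤ N := (Nat.le_self_pow two_ne_zero _).trans hSN
  have hdecomp := sum_one_div_mul_sum_eq (ν := ν) hS₀ ha₀
  have hTK := sum_abs_sub_divisorCountIn_le hS₀ hcop hA hSN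
  have hdilate := sum_norm_sum_mul_dilate_le hν₁ ha₁ ha₀ hS₀ hSN' hA hcorr
  have hdefect := norm_sum_sum_mul_defect_le hν hν₁ ha₁ ha₀ hS hSN'
  set A : ℝ := ∑ p ∈ S, (1 : ℝ) / p
  have hsqrt : 1 ≤ √A := Real.one_le_sqrt.2 hA
  refine le_of_mul_le_mul_left ?_ (zero_lt_one.trans_le hsqrt)
  calc √A * (√A * ‖∑ n ∈ range N, a n * ν n‖)
      = ‖(A : ℂ) * ∑ n ∈ range N, a n * ν n‖ := by
        rw [← mul_assoc, Real.mul_self_sqrt (by linarith), norm_mul, Complex.norm_real,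
          Real.norm_of_nonneg (by linarith)]
    _ ≤ 2 * √A * N + (2 * √A * N + 4 * N) := by
        rw [hdecomp]
        refine norm_add_le_of_le ?_ (norm_add_le_of_le ?_ hdefect)
        · refine (norm_sum_le_of_le _ fun n _ => ?_).trans hTK
          rw [norm_mul, Complex.norm_real]
          exact mul_le_of_le_one_right (norm_nonneg _) (norm_mul_le_one (ha₁ n) (hν₁ n))
        · refine (norm_sum_le_of_le _ fun m _ => ?_).trans hdilate
          rw [norm_mul]
          exact mul_le_of_le_one_left (norm_nonneg _) (hν₁ m)
    _ ≤ √A * (8 * N) := by nlinarith [mul_le_mul_of_nonneg_right hsqrt N.cast_nonneg]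

end Katai

section ShortIntervals

variable {ν : ArithmeticFunction ℂ} {u : ℕ → ℂ}

theorem sqrt_mul_sum_norm_sum_Ico_le (hν : ν.IsMultiplicative) (hν₁ : ∀ n, ‖ν n‖ ≤ 1)
    (hu : ∀ n, ‖u n‖ ≤ 1) {S : Finset ℕ} (hS : ∀ p ∈ S, p.Prime) (hA : 1 ≤ ∑ p ∈ S, (1 : ℝ) / p)
    {C : ℝ} (hC : 0 ≤ C)
    (hcorr : ∀ p ∈ S, ∀ q ∈ S, p ≠ q → ∀ a L : ℕ,
      ‖∑ m ∈ range L, u (p * (a + m)) * conj (u (q * (a + m)))‖ ≤ 1 / (2 * (#S : ℝ) ^ 2) * L + C)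
    {ι : Type*} {T : Finset ι} {l r : ι → ℕ}
    (hdisj : (T : Set ι).PairwiseDisjoint fun t => Ico (l t) (r t)) {N : ℕ}
    (hr : ∀ t ∈ T, r t ≤ N) (hSN : #S ^ 2 ≤ N) (hTN : 8 * C * #S ^ 2 * (#T + 1) ≤ N) :
    √(∑ p ∈ S, (1 : ℝ) / p) * ∑ t ∈ T, ‖∑ n ∈ Ico (l t) (r t), u n * ν n‖ ≤ 8 * N := by
  choose c hc hc_mul using fun t =>
    RCLike.exists_norm_eq_mul_self (∑ n ∈ Ico (l t) (r t), u n * ν n)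
  set W := stepFunction T l r c
  have hsum : ∑ n ∈ range N, W n * u n * ν n =
      (∑ t ∈ T, ‖∑ n ∈ Ico (l t) (r t), u n * ν n‖ : ℝ) := by
    simp only [mul_assoc]
    rw [sum_range_stepFunction_mul hr, Complex.ofReal_sum]
    exact sum_congr rfl fun t _ => (hc_mul t).symm
  have hW (n : ℕ) : ‖W n * u n‖ ≤ 1 :=
    norm_mul_le_one (norm_stepFunction_le hdisj (fun t => (hc t).le) n) (hu n)
  have hW₀ (n : ℕ) (hn : N ≤ n) : W n * u n = 0 := by
    rw [show W n = 0 from stepFunction_eq_zero hr hn, zero_mul]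
  have hWcorr : ∀ p ∈ S, ∀ q ∈ S, p ≠ q →
      ‖∑ m ∈ range N, W (p * m) * u (p * m) * conj (W (q * m) * u (q * m))‖ ≤ N / (#S : ℝ) ^ 2 := by
    intro p hp q hq hpq
    have hS_pos : (0 : ℝ) < #S := mod_cast card_pos.2 ⟨p, hp⟩
    refine (norm_sum_range_stepFunction_correlation_le hdisj (fun t => (hc t).le) hC
      (hcorr p hp q hq hpq) N).trans ?_
    rw [le_div_iff₀ (by positivity)]
    have hCS : 0 ≤ C * (#S : ℝ) ^ 2 := by positivity
    calc (1 / (2 * (#S : ℝ) ^ 2) * N + C * (4 * #T + 1)) * (#S : ℝ) ^ 2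
        = N / 2 + C * (#S : ℝ) ^ 2 * (4 * #T + 1) := by field_simp
      _ ≤ (N : ℝ) := by linarith
  have hkatai := katai_criterion hν hν₁ hW hW₀ hS hSN hA hWcorr
  rwa [hsum, Complex.norm_real, Real.norm_of_nonneg (by positivity)] at hkatai

theorem exists_sum_norm_sum_Ico_le (hν : ν.IsMultiplicative) (hν₁ : ∀ n, ‖ν n‖ ≤ 1)
    (hu : ∀ n, ‖u n‖ ≤ 1)
    (hcorr : ∀ p q : ℕ, p.Prime → q.Prime → p ≠ q →
      HasUniformMeanZero fun m => u (p * m) * conj (u (q * m)))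
    {ε : ℝ} (hε : 0 < ε) (ι : Type*) :
    ∃ R : ℕ, ∀ (T : Finset ι) (l r : ι → ℕ) (N : ℕ),
      (T : Set ι).PairwiseDisjoint (fun t => Ico (l t) (r t)) → (∀ t ∈ T, r t ≤ N) →
      R * (#T + 1) ≤ N → ∑ t ∈ T, ‖∑ n ∈ Ico (l t) (r t), u n * ν n‖ ≤ ε * N := by
  obtain ⟨S, hS, hSA⟩ := exists_primes_sum_one_div_gt (max 1 ((8 / ε) ^ 2))
  have hA : 1 ≤ ∑ p ∈ S, (1 : ℝ) / p := (le_max_left _ _).trans hSA.le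
  have hAε : 8 / ε ≤ √(∑ p ∈ S, (1 : ℝ) / p) :=
    Real.le_sqrt_of_sq_le ((le_max_right _ _).trans hSA.le)
  have hS_pos : (0 : ℝ) < #S := by
    refine mod_cast card_pos.2 (nonempty_of_sum_ne_zero (f := fun p : ℕ => (1 : ℝ) / p) ?_)
    exact (one_pos.trans_le hA).ne'
  have hC_eventually : ∀ᶠ C : ℝ in atTop, ∀ p ∈ S, ∀ q ∈ S, p ≠ q → ∀ a L : ℕ,
      ‖∑ m ∈ range L, u (p * (a + m)) * conj (u (q * (a + m)))‖ ≤
        1 / (2 * (#S : ℝ) ^ 2) * L + C := by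
    simp only [eventually_all_finset, eventually_imp_distrib_left]
    exact fun p hp q hq hpq => (hcorr p q (hS p hp) (hS q hq) hpq).eventually_le (by positivity)
  obtain ⟨C, hC, hC₀⟩ := (hC_eventually.and (eventually_ge_atTop 0)).exists
  obtain ⟨R, hR⟩ := exists_nat_ge (max (#S ^ 2 : ℝ) (8 * C * #S ^ 2))
  refine ⟨R, fun T l r N hdisj hr hRN => ?_⟩
  have hRN' : (R : ℝ) * (#T + 1) ≤ N := mod_cast hRN
  have hSN : (#S : ℝ) ^ 2 ≤ N := by
    refine ((le_max_left _ _).trans hR).trans (le_trans ?_ hRN')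
    exact le_mul_of_one_le_right R.cast_nonneg (le_add_of_nonneg_left (Nat.cast_nonneg _))
  have hTN : 8 * C * #S ^ 2 * (#T + 1) ≤ N := by
    refine le_trans ?_ hRN'
    gcongr
    exact (le_max_right _ _).trans hR
  have hbound := (mul_le_mul_of_nonneg_right hAε (by positivity)).trans <|
    sqrt_mul_sum_norm_sum_Ico_le hν hν₁ hu hS hA hC₀ hC hdisj hr (mod_cast hSN) hTN
  rw [div_mul_eq_mul_div, div_le_iff₀ hε] at hbound
  linarith

lemma pairwiseDisjoint_Ico_add_of_mod_eq {T : Finset ℕ} {H r : ℕ} (hT : ∀ t ∈ T, t % H = r) :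
    (T : Set ℕ).PairwiseDisjoint fun t => Ico t (t + H) := by
  intro s hs t ht hst
  wlog hlt : s < t generalizing s t
  · exact (this ht hs hst.symm (lt_of_le_of_ne (not_lt.1 hlt) hst.symm)).symm
  have hgap : H ≤ t - s := Nat.le_of_dvd (Nat.sub_pos_of_lt hlt)
    ((Nat.modEq_iff_dvd' hlt.le).1 ((hT s hs).trans (hT t ht).symm))
  exact disjoint_left.2 fun n hns hnt => by rw [mem_Ico] at hns hnt; lia

lemma card_mul_le_of_pairwiseDisjoint_Ico {T : Finset ℕ} {H N : ℕ}
    (hdisj : (T : Set ℕ).PairwiseDisjoint fun t => Ico t (t + H)) (hN : ∀ t ∈ T, t + H ≤ N) :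
    #T * H ≤ N := by
  have hsub : T.biUnion (fun t => Ico t (t + H)) ⊆ range N := biUnion_subset.2 fun t ht n hn =>
    mem_range.2 ((mem_Ico.1 hn).2.trans_le (hN t ht))
  simpa [card_biUnion hdisj] using card_le_card hsub

lemma card_image_mod_Ico_le_min (M : ℕ) {H : ℕ} (hH : 0 < H) :
    #((Ico M (2 * M)).image (· % H)) ≤ min M H := by
  refine le_min (card_image_le.trans_eq (by rw [Nat.card_Ico]; lia)) ?_
  simpa using card_le_card (image_subset_iff.2 fun m _ => mem_range.2 (Nat.mod_lt m hH))

theorem eventually_sum_norm_sum_Ico_add_le (hν : ν.IsMultiplicative) (hν₁ : ∀ n, ‖ν n‖ ≤ 1)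
    (hu : ∀ n, ‖u n‖ ≤ 1)
    (hcorr : ∀ p q : ℕ, p.Prime → q.Prime → p ≠ q →
      HasUniformMeanZero fun m => u (p * m) * conj (u (q * m)))
    {ε : ℝ} (hε : 0 < ε) :
    ∀ᶠ p : ℕ × ℕ in atTop ×ˢ atTop,
      ∑ m ∈ Ico p.1 (2 * p.1), ‖∑ n ∈ Ico m (m + p.2), u n * ν n‖ ≤ ε * (p.1 * p.2) := by
  obtain ⟨R, hR⟩ := exists_sum_norm_sum_Ico_le hν hν₁ hu hcorr (ε := ε / 3) (by positivity) ℕ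
  filter_upwards [(eventually_ge_atTop R).prod_mk (eventually_ge_atTop (2 * R + 1))]
  rintro ⟨M, H⟩ ⟨hM, hH⟩
  dsimp only at hM hH ⊢
  have hclass (r : ℕ) : ∑ m ∈ Ico M (2 * M) with m % H = r, ‖∑ n ∈ Ico m (m + H), u n * ν n‖ ≤
      ε / 3 * (2 * M + H : ℕ) := by
    set T := {m ∈ Ico M (2 * M) | m % H = r}
    have hdisj : (T : Set ℕ).PairwiseDisjoint fun t => Ico t (t + H) :=
      pairwiseDisjoint_Ico_add_of_mod_eq fun t ht => (mem_filter.1 ht).2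
    have hT : ∀ t ∈ T, t + H ≤ 2 * M + H := fun t ht =>
      add_le_add_left (mem_Ico.1 (mem_filter.1 ht).1).2.le H
    refine hR T id (· + H) _ hdisj hT ?_
    nlinarith [card_mul_le_of_pairwiseDisjoint_Ico hdisj hT]
  set I := (Ico M (2 * M)).image (· % H)
  have hI : #I * (2 * M + H) ≤ 3 * (M * H) := by
    have hmin := card_image_mod_Ico_le_min M (by lia : 0 < H)
    nlinarith [hmin.trans (min_le_left _ _), hmin.trans (min_le_right _ _)]
  calc ∑ m ∈ Ico M (2 * M), ‖∑ n ∈ Ico m (m + H), u n * ν n‖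
      = ∑ r ∈ I, ∑ m ∈ Ico M (2 * M) with m % H = r, ‖∑ n ∈ Ico m (m + H), u n * ν n‖ :=
        (sum_fiberwise_of_maps_to (fun m hm => mem_image_of_mem _ hm) _).symm
    _ ≤ #I * (ε / 3 * (2 * M + H : ℕ)) := by
        rw [← nsmul_eq_mul]
        exact sum_le_card_nsmul _ _ _ fun r _ => hclass r
    _ = ε / 3 * (#I * (2 * M + H) : ℕ) := by push_cast; ring
    _ ≤ ε / 3 * (3 * (M * H) : ℕ) := by gcongr
    _ = ε * (M * H) := by push_cast; ring

theorem tendsto_average_norm_sum_Ico_add (hν : ν.IsMultiplicative) (hν₁ : ∀ n, ‖ν n‖ ≤ 1)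
    (hu : ∀ n, ‖u n‖ ≤ 1)
    (hcorr : ∀ p q : ℕ, p.Prime → q.Prime → p ≠ q →
      HasUniformMeanZero fun m => u (p * m) * conj (u (q * m))) :
    Tendsto
      (fun p : ℕ × ℕ => (1 / (p.1 : ℝ)) * ∑ m ∈ Ico p.1 (2 * p.1),
        (1 / (p.2 : ℝ)) * ‖∑ n ∈ Ico m (m + p.2), u n * ν n‖)
      (atTop ×ˢ atTop) (𝓝 0) := by
  refine Metric.tendsto_nhds.2 fun ε hε => ?_
  filter_upwards [eventually_sum_norm_sum_Ico_add_le hν hν₁ hu hcorr (half_pos hε),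
    (eventually_gt_atTop 0).prod_mk (eventually_gt_atTop 0)]
  rintro ⟨M, H⟩ hsum ⟨hM, hH⟩
  dsimp only at hsum hM hH ⊢
  rw [Real.dist_0_eq_abs, abs_of_nonneg (by positivity), ← mul_sum]
  calc (1 / (M : ℝ)) * ((1 / H) * ∑ m ∈ Ico M (2 * M), ‖∑ n ∈ Ico m (m + H), u n * ν n‖)
      ≤ (1 / (M : ℝ)) * ((1 / H) * (ε / 2 * (M * H))) := by gcongr
    _ = ε / 2 := by field_simp
    _ < ε := half_lt_self hε

end ShortIntervals

theorem theorem5_general (ν : ArithmeticFunction ℂ) (hν : ν.IsMultiplicative)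
    (hν_bound : ∀ n : ℕ, ‖ν n‖ ≤ 1)
    (P : Polynomial ℝ) (hP : P.natDegree ≠ 0) (hP_irr : Irrational P.leadingCoeff) :
    Tendsto
      (fun p : ℕ × ℕ =>
        (1 / (p.1 : ℝ)) * ∑ m ∈ Finset.Ico p.1 (2 * p.1),
          (1 / (p.2 : ℝ)) * ‖∑ n ∈ Finset.Ico m (m + p.2),
            Complex.exp (2 * (Real.pi : ℂ) * Complex.I * ((P.eval (n : ℝ) : ℝ) : ℂ)) * ν n‖)
      (atTop ×ˢ atTop) (𝓝 0) := by
  have hexp (x : ℝ) : Complex.exp (2 * (Real.pi : ℂ) * Complex.I * (x : ℂ)) = 𝐞 x := by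
    rw [Real.fourierChar_apply]
    push_cast
    ring_nf
  simp only [hexp]
  exact tendsto_average_norm_sum_Ico_add (u := fun n => 𝐞 (P.eval (n : ℝ))) hν hν_bound
    (fun n => (Circle.norm_coe _).le)
    fun p q _ _ hpq => hasUniformMeanZero_fourierChar_eval_dilates hP hP_irr hpq

theorem theorem5 (ν : ArithmeticFunction ℂ) (hν : ν.IsMultiplicative)
    (hν_bound : ∀ n : ℕ, ‖ν n‖ ≤ 1)
    (P : Polynomial ℝ) (hP : P.natDegree ≠ 0) (hP_irr : Irrational P.leadingCoeff) :
    Tendsto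
      (fun p : ℕ × ℕ =>
        (1 / (p.1 : ℝ)) * ∑ m ∈ Finset.Ico p.1 (2 * p.1),
          (1 / (p.2 : ℝ)) * ‖∑ n ∈ Finset.Ico m (m + p.2),
            Complex.exp (2 * (Real.pi : ℂ) * Complex.I * ((P.eval (n : ℝ) : ℝ) : ℂ)) * ν n‖)
      ((atTop ×ˢ atTop) ⊓ comap (fun p : ℕ × ℕ => (p.2 : ℝ) / (p.1 : ℝ)) (𝓝 0))
      (𝓝 0) :=
  (theorem5_general ν hν hν_bound P hP hP_irr).mono_left inf_le_left
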